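/- **Patterns.** A quadrilateral with cyclically ordered corners (top left $TL$, top right $TR$, bottom right $BR$, bottom left $BL$) is *subdivided* by adding the midpoints $U,R,D,L$ of its top, right, bottom and left sides (the *side* vertices) and three *inner* vertices $A,B,C$, halving the sides, and adding the eight edges joining $A$ to $U$, $L$, $C$; $B$ to $U$, $R$, $C$; and $C$ to the corners $BL$ and $BR$. The result consists of six quadrilateral *tiles*, which are again given with corners in the order (top left, top right, bottom right, bottom left): $$(TL,U,A,L),\quad (TR,R,B,U),\quad (A,U,B,C),\quad (BL,L,A,C),\quad (BR,C,B,R),\quad (BR,D,BL,C).$$ **The complexes.** The complex of level $1$ is the graph of one subdivided quadrilateral with its six tiles; all its vertices have level $0$. The complex of level $n+1$ is obtained from the complex of level $n$ by the following two operations. *Subdivision.* Every edge receives a midpoint (a side vertex) and every tile is subdivided as above, according to its own orientation. All new vertices get the level one more than the maximal level before. A *macrotile* is any quadrilateral that is, or at some earlier stage was, a tile, as well as the original quadrilateral and every pasted quadrilateral (see below). *Pasting.* Let $k$ be the maximal level of a vertex after the subdivision. Consider all paths $X_1X_2YZ_2Z_1$ with five distinct vertices such that: (1) $X_1,Y,Z_1$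 are not three of the four corners of any macrotile; (2) $X_1,Z_1$ are side vertices of level $k-1$; (3) $X_2$ and $Z_2$ are the midpoints of $X_1Y$ and $Z_1Y$ created by the last subdivision; (4) $Y$ has level $k-2$. For each such path (where it is immaterial which end is called $X_1$) add a new subdivided quadrilateral whose top right, top left and bottom left corners are $X_1,Y,Z_1$ and whose top and left sides are $X_1X_2Y$ and $YZ_2Z_1$; its other six vertices are new, namely the bottom right corner $T_1$, of level $k-1$, and the midpoints $T_2$ (right) and $T_3$ (bottom), which are side vertices, and three inner vertices, all of level $k$. Its six tiles are added to the tiles of the complex. Every vertex of the complex of level $n$ is also a vertex of the complexes of all higher levels. **Proposition.** Let $X$ be a vertex of the complex of some level $n\ge 1$. Then there is a natural number $N\ge n$ such that the degree of $X$ (the number of edges at $X$) in the complex of level $N$ is finite, and for every natural number $k$ the degree of $X$ in the complex of level $N+k$ equals its degree in the complex of level $N$. This holds for any convention on which end of each path is called $X_1$, even if the pasting is performed for both directions of some paths. -/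

import Mathlib

/-! Combinatorial construction of the iterated complex. -/

/-- The role of a vertex: a corner, a side (boundary) vertex, or an inner (black) vertex. -/
inductive VKind where
  | corner
  | side
  | inner

/-- An oriented quadrilateral, given by its four corners in cyclic order: top left, top right,
bottom right, bottom left. -/
structure Quad (V : Type) where
  tl : V
  tr : V
  br : V
  bl : V

namespace Quad

/-- The four corners of a quadrilateral. -/
def corners {V : Type} (q : Quad V) : Set V := {q.tl, q.tr, q.br, q.bl}

/-- The image of a quadrilateral under a map of vertices. -/
def map {V W : Type} (f : V → W) (q : Quad V) : Quad W := ⟨f q.tl, f q.tr, f q.br, f q.bl⟩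

/-- The four sides of the quadrilateral are edges of `G`. -/
def IsCycle {V : Type} (G : SimpleGraph V) (q : Quad V) : Prop :=
  G.Adj q.tl q.tr ∧ G.Adj q.tr q.br ∧ G.Adj q.br q.bl ∧ G.Adj q.bl q.tl

end Quad

/-- The eleven vertices of a quadrilateral that has been subdivided once: the corners
`tl, tr, br, bl`, the midpoints `u, r, d, l` of the top, right, bottom and left sides, and the
inner vertices `a, b, c`. -/
structure Pattern (V : Type) where
  tl : V
  tr : V
  br : V
  bl : V
  u : V
  r : V
  d : V
  l : V
  a : V
  b : V
  c : V

namespace Pattern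

variable {V : Type}

/-- The quadrilateral that is subdivided. -/
def outer (P : Pattern V) : Quad V := ⟨P.tl, P.tr, P.br, P.bl⟩

/-- The sixteen edges of a subdivided quadrilateral: eight halves of the sides and eight inner
edges. -/
def edges (P : Pattern V) : Set (Sym2 V) :=
  {s(P.tl, P.u), s(P.u, P.tr), s(P.tr, P.r), s(P.r, P.br),
   s(P.br, P.d), s(P.d, P.bl), s(P.bl, P.l), s(P.l, P.tl),
   s(P.u, P.a), s(P.u, P.b), s(P.a, P.l), s(P.a, P.c),
   s(P.b, P.c), s(P.b, P.r), s(P.c, P.bl), s(P.c, P.br)}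

/-- The six oriented tiles of a subdivided quadrilateral, in the order: left upper, right upper,
middle, left lower, right lower, bottom. Each is listed from its own top left corner on. -/
def tiles (P : Pattern V) : Set (Quad V) :=
  {⟨P.tl, P.u, P.a, P.l⟩,
   ⟨P.tr, P.r, P.b, P.u⟩,
   ⟨P.a, P.u, P.b, P.c⟩,
   ⟨P.bl, P.l, P.a, P.c⟩,
   ⟨P.br, P.c, P.b, P.r⟩,
   ⟨P.br, P.d, P.bl, P.c⟩}

theorem isCycle_of_mem_tiles (P : Pattern V) (G : SimpleGraph V)
    (h : ∀ e ∈ P.edges, e ∈ G.edgeSet) : ∀ q ∈ P.tiles, q.IsCycle G := by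
  simp only [edges, Set.mem_insert_iff, Set.mem_singleton_iff, forall_eq_or_imp, forall_eq,
    SimpleGraph.mem_edgeSet] at h
  obtain ⟨h1, h2, h3, h4, h5, h6, h7, h8, h9, h10, h11, h12, h13, h14, h15, h16⟩ := h
  intro q hq
  simp only [tiles, Set.mem_insert_iff, Set.mem_singleton_iff] at hq
  rcases hq with rfl | rfl | rfl | rfl | rfl | rfl <;>
    refine ⟨?_, ?_, ?_, ?_⟩ <;> first | assumption | (apply SimpleGraph.Adj.symm; assumption)

end Pattern

/-- A complex: a graph whose vertices carry a level and a role, with its set of oriented tiles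
and the set of all its macrotiles (of all sizes, the tiles being the smallest ones). -/
structure TileComplex where
  V : Type
  graph : SimpleGraph V
  level : V → ℕ
  kind : V → VKind
  tiles : Set (Quad V)
  macrotiles : Set (Quad V)
  tiles_isCycle : ∀ q ∈ tiles, q.IsCycle graph

namespace TileComplex

/-- The maximal level of a vertex. -/
noncomputable def maxLevel (K : TileComplex) : ℕ := sSup (Set.range K.level)

/-- The degree of a vertex: the number of edges at it. -/
noncomputable def degree (K : TileComplex) (v : K.V) : ℕ∞ := (K.graph.neighborSet v).encard

/-! ### The complex of level one -/

inductive BaseVertex where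
  | tl | tr | br | bl | u | r | d | l | a | b | c

/-- The vertices of the complex of level one as a subdivided quadrilateral. -/
def basePattern : Pattern BaseVertex where
  tl := .tl
  tr := .tr
  br := .br
  bl := .bl
  u := .u
  r := .r
  d := .d
  l := .l
  a := .a
  b := .b
  c := .c

/-- The role of a vertex in the complex of level one. -/
def baseKind : BaseVertex → VKind
  | .tl | .tr | .br | .bl => .corner
  | .u | .r | .d | .l => .side
  | .a | .b | .c => .inner

/-- The complex of level one: a single quadrilateral divided into six tiles. -/
def base : TileComplex where
  V := BaseVertex
  graph := SimpleGraph.fromEdgeSet basePattern.edges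
  level _ := 0
  kind := baseKind
  tiles := basePattern.tiles
  macrotiles := {basePattern.outer} ∪ basePattern.tiles
  tiles_isCycle := by
    apply Pattern.isCycle_of_mem_tiles
    intro e he
    simp only [SimpleGraph.edgeSet_fromEdgeSet, Set.mem_sdiff]
    refine ⟨he, ?_⟩
    simp only [Pattern.edges, basePattern, Set.mem_insert_iff, Set.mem_singleton_iff] at he
    rcases he with rfl | rfl | rfl | rfl | rfl | rfl | rfl | rfl | rfl | rfl | rfl | rfl | rfl |
      rfl | rfl | rfl <;> simp

/-! ### Subdivision -/

inductive InnerName where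
  | a | b | c

/-- The vertices after subdivision: the old vertices, a midpoint for every edge, and three inner
vertices for every tile. -/
inductive SubVertex (K : TileComplex) where
  | old (v : K.V)
  | mid (e : K.graph.edgeSet)
  | inner (q : K.tiles) (i : InnerName)

/-- The subdivision pattern in a tile. -/
def subPattern (K : TileComplex) (q : K.tiles) : Pattern K.SubVertex where
  tl := .old q.1.tl
  tr := .old q.1.tr
  br := .old q.1.br
  bl := .old q.1.bl
  u := .mid ⟨s(q.1.tl, q.1.tr), (K.tiles_isCycle q.1 q.2).1⟩
  r := .mid ⟨s(q.1.tr, q.1.br), (K.tiles_isCycle q.1 q.2).2.1⟩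
  d := .mid ⟨s(q.1.br, q.1.bl), (K.tiles_isCycle q.1 q.2).2.2.1⟩
  l := .mid ⟨s(q.1.bl, q.1.tl), (K.tiles_isCycle q.1 q.2).2.2.2⟩
  a := .inner q .a
  b := .inner q .b
  c := .inner q .c

/-- The edges after subdivision: the halves of the old edges, and the edges of the subdivision
patterns of the tiles. -/
def subEdges (K : TileComplex) : Set (Sym2 K.SubVertex) :=
  {x | ∃ (e : K.graph.edgeSet) (v : K.V), v ∈ e.1 ∧ x = s(.old v, .mid e)} ∪
    ⋃ q : K.tiles, (K.subPattern q).edges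

/-- The role of a vertex after subdivision. -/
def subKind (K : TileComplex) : K.SubVertex → VKind
  | .old v => K.kind v
  | .mid _ => .side
  | .inner _ _ => .inner

/-- The level of a vertex after subdivision: all new vertices get the level one more than the
maximal level before. -/
noncomputable def subLevel (K : TileComplex) : K.SubVertex → ℕ
  | .old v => K.level v
  | .mid _ => K.maxLevel + 1
  | .inner _ _ => K.maxLevel + 1

/-- Subdivision: every tile is divided into six tiles and becomes a macrotile. -/
noncomputable def subdivide (K : TileComplex) : TileComplex where
  V := K.SubVertex
  graph := SimpleGraph.fromEdgeSet K.subEdges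
  level := K.subLevel
  kind := K.subKind
  tiles := ⋃ q : K.tiles, (K.subPattern q).tiles
  macrotiles := Quad.map .old '' K.macrotiles ∪ ⋃ q : K.tiles, (K.subPattern q).tiles
  tiles_isCycle := by
    intro t ht
    obtain ⟨q, hq⟩ := Set.mem_iUnion.1 ht
    refine (K.subPattern q).isCycle_of_mem_tiles _ ?_ t hq
    intro e he
    simp only [SimpleGraph.edgeSet_fromEdgeSet, Set.mem_sdiff]
    refine ⟨Or.inr (Set.mem_iUnion.2 ⟨q, he⟩), ?_⟩
    simp only [Pattern.edges, subPattern, Set.mem_insert_iff, Set.mem_singleton_iff] at he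
    rcases he with rfl | rfl | rfl | rfl | rfl | rfl | rfl | rfl | rfl | rfl | rfl | rfl | rfl |
      rfl | rfl | rfl <;> simp

/-- `m` is the midpoint, created by the last subdivision, of the former edge from `x` to `y`. -/
inductive IsNewMid (K : TileComplex) : K.SubVertex → K.SubVertex → K.SubVertex → Prop
  | intro (x y : K.V) (h : K.graph.Adj x y) : IsNewMid K (.mid ⟨s(x, y), h⟩) (.old x) (.old y)

/-! ### Pasting -/

/-- The paths `x₁ x₂ y z₂ z₁` in the subdivided complex at which a macrotile is pasted. -/
structure PastePath (K : TileComplex) where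
  x₁ : K.subdivide.V
  x₂ : K.subdivide.V
  y : K.subdivide.V
  z₂ : K.subdivide.V
  z₁ : K.subdivide.V
  nodup : [x₁, x₂, y, z₂, z₁].Nodup
  adj_x₁ : K.subdivide.graph.Adj x₁ x₂
  adj_x₂ : K.subdivide.graph.Adj x₂ y
  adj_z₂ : K.subdivide.graph.Adj y z₂
  adj_z₁ : K.subdivide.graph.Adj z₂ z₁
  not_corners : ¬ ∃ M ∈ K.subdivide.macrotiles, x₁ ∈ M.corners ∧ y ∈ M.corners ∧ z₁ ∈ M.corners
  kind_x₁ : K.subdivide.kind x₁ = .side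
  kind_z₁ : K.subdivide.kind z₁ = .side
  level_x₁ : K.subdivide.level x₁ + 1 = K.subdivide.maxLevel
  level_z₁ : K.subdivide.level z₁ + 1 = K.subdivide.maxLevel
  mid_x₂ : K.IsNewMid x₂ x₁ y
  mid_z₂ : K.IsNewMid z₂ z₁ y
  level_y : K.subdivide.level y + 2 = K.subdivide.maxLevel

/-- The same path, traversed in the opposite direction. -/
def PastePath.reverse {K : TileComplex} (p : K.PastePath) : K.PastePath where
  x₁ := p.z₁
  x₂ := p.z₂
  y := p.y
  z₂ := p.x₂
  z₁ := p.x₁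
  nodup := by simpa using List.nodup_reverse.2 p.nodup
  adj_x₁ := p.adj_z₁.symm
  adj_x₂ := p.adj_z₂.symm
  adj_z₂ := p.adj_x₂.symm
  adj_z₁ := p.adj_x₁.symm
  not_corners := fun ⟨M, hM, h1, h2, h3⟩ => p.not_corners ⟨M, hM, h3, h2, h1⟩
  kind_x₁ := p.kind_z₁
  kind_z₁ := p.kind_x₁
  level_x₁ := p.level_z₁
  level_z₁ := p.level_x₁
  mid_x₂ := p.mid_z₂
  mid_z₂ := p.mid_x₂
  level_y := p.level_y

inductive PasteName where
  | t₁ | t₂ | t₃ | a | b | c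

/-- The vertices after pasting along the paths in `S`: the old vertices and six new vertices for
every path. -/
inductive PasteVertex (K : TileComplex) (S : Set K.PastePath) where
  | old (v : K.subdivide.V)
  | new (p : S) (i : PasteName)

/-- The macrotile pasted along a path: top right corner `x₁`, top left corner `y`, bottom left
corner `z₁`, bottom right corner `t₁`. -/
def pastePattern (K : TileComplex) (S : Set K.PastePath) (p : S) :
    Pattern (K.PasteVertex S) where
  tl := .old p.1.y
  tr := .old p.1.x₁
  br := .new p .t₁
  bl := .old p.1.z₁
  u := .old p.1.x₂
  r := .new p .t₂
  d := .new p .t₃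
  l := .old p.1.z₂
  a := .new p .a
  b := .new p .b
  c := .new p .c

/-- The edges after pasting. -/
def pasteEdges (K : TileComplex) (S : Set K.PastePath) : Set (Sym2 (K.PasteVertex S)) :=
  Sym2.map .old '' K.subdivide.graph.edgeSet ∪ ⋃ p : S, (K.pastePattern S p).edges

/-- The role of a vertex after pasting. -/
noncomputable def pasteKind (K : TileComplex) (S : Set K.PastePath) : K.PasteVertex S → VKind
  | .old v => K.subdivide.kind v
  | .new _ .t₁ => .corner
  | .new _ .t₂ => .side
  | .new _ .t₃ => .side
  | .new _ .a => .inner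
  | .new _ .b => .inner
  | .new _ .c => .inner

/-- The level of a vertex after pasting: with `k` the maximal level before, `t₁` has level `k - 1`
and the other new vertices have level `k`. -/
noncomputable def pasteLevel (K : TileComplex) (S : Set K.PastePath) : K.PasteVertex S → ℕ
  | .old v => K.subdivide.level v
  | .new _ .t₁ => K.subdivide.maxLevel - 1
  | .new _ _ => K.subdivide.maxLevel

theorem pasteEdges_not_isDiag (K : TileComplex) (S : Set K.PastePath)
    (e : Sym2 (K.PasteVertex S)) (he : e ∈ K.pasteEdges S) : ¬ e.IsDiag := by
  rcases he with ⟨e, he, rfl⟩ | he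
  · induction e using Sym2.ind with
    | _ x y => simpa using K.subdivide.graph.ne_of_adj he
  · obtain ⟨p, he⟩ := Set.mem_iUnion.1 he
    have h1 := p.1.adj_x₁.ne
    have h2 := p.1.adj_x₂.ne
    have h3 := p.1.adj_z₂.ne
    have h4 := p.1.adj_z₁.ne
    simp only [Pattern.edges, pastePattern, Set.mem_insert_iff, Set.mem_singleton_iff] at he
    rcases he with rfl | rfl | rfl | rfl | rfl | rfl | rfl | rfl | rfl | rfl | rfl | rfl | rfl |
      rfl | rfl | rfl <;> simp [h1.symm, h2.symm, h3.symm, h4.symm]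

/-- Subdivision followed by pasting along the paths in `S`. -/
noncomputable def subdividePaste (K : TileComplex) (S : Set K.PastePath) : TileComplex where
  V := K.PasteVertex S
  graph := SimpleGraph.fromEdgeSet (K.pasteEdges S)
  level := K.pasteLevel S
  kind := K.pasteKind S
  tiles := Quad.map .old '' K.subdivide.tiles ∪ ⋃ p : S, (K.pastePattern S p).tiles
  macrotiles := Quad.map .old '' K.subdivide.macrotiles ∪
    ⋃ p : S, {(K.pastePattern S p).outer} ∪ (K.pastePattern S p).tiles
  tiles_isCycle := by
    have key : ∀ e ∈ K.pasteEdges S, e ∈ (SimpleGraph.fromEdgeSet (K.pasteEdges S)).edgeSet :=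
      fun e he => by
        rw [SimpleGraph.edgeSet_fromEdgeSet]
        exact ⟨he, K.pasteEdges_not_isDiag S e he⟩
    rintro t (⟨q, hq, rfl⟩ | ht)
    · have hk : ∀ x y, K.subdivide.graph.Adj x y →
          (SimpleGraph.fromEdgeSet (K.pasteEdges S)).Adj (.old x) (.old y) :=
        fun x y h => key _ (Or.inl ⟨s(x, y), h, rfl⟩)
      obtain ⟨h1, h2, h3, h4⟩ := K.subdivide.tiles_isCycle q hq
      exact ⟨hk _ _ h1, hk _ _ h2, hk _ _ h3, hk _ _ h4⟩
    · obtain ⟨p, hp⟩ := Set.mem_iUnion.1 ht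
      exact (K.pastePattern S p).isCycle_of_mem_tiles _
        (fun e he => key e (Or.inr (Set.mem_iUnion.2 ⟨p, he⟩))) t hp

/-- A convention fixing which end of an (undirected) path plays the part of `x₁` in a pasting:
of the two directions of every path at least one is chosen. -/
structure PastingRule where
  chosen : (K : TileComplex) → Set K.PastePath
  chosen_or : ∀ (K : TileComplex) (p : K.PastePath), p ∈ chosen K ∨ p.reverse ∈ chosen K

/-- One iteration: subdivision, then pasting along all paths. -/
noncomputable def next (ρ : PastingRule) (K : TileComplex) : TileComplex :=
  K.subdividePaste (ρ.chosen K)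

/-- A vertex of a complex as a vertex of the next one. -/
def toNext (ρ : PastingRule) (K : TileComplex) (v : K.V) : (K.next ρ).V :=
  PasteVertex.old (SubVertex.old v)

/-- The iterated complex; `iterated ρ n` is the complex of level `n + 1`. -/
noncomputable def iterated (ρ : PastingRule) : ℕ → TileComplex
  | 0 => base
  | n + 1 => (iterated ρ n).next ρ

/-- A vertex of a complex of the sequence as a vertex of a later complex. -/
noncomputable def transport (ρ : PastingRule) {n m : ℕ} (h : n ≤ m) (v : (iterated ρ n).V) :
    (iterated ρ m).V :=
  Nat.leRecOn (C := fun j => (iterated ρ j).V) h (fun {j} w => toNext ρ (iterated ρ j) w) v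

end TileComplex

namespace TileComplex

/-! A vertex keeps its level while the maximal level grows by one at each iteration, so after two
iterations the vertex is `Settled`: its level is too low for any later pasting path
(`Settled.notMem_path`), and only subdivision can change its degree. Subdivision replaces each edge
at an old vertex by half of it, and adds an edge to the inner vertex `c` of each tile having the
vertex as a bottom corner (`subdivide_adj_old_iff`). The degree is therefore constant once the
vertex is no bottom corner of any tile. The orientation of the six tiles ensures this: an old vertex
is never bottom left in a new tile, and bottom right only if it was bottom left before
(`corner_of_mem_tiles_subdivide`). Two more iterations thus make a settled vertex `Stable`, and
stability persists. The convention for directing paths plays no role. -/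

/-! ### Finiteness of the complexes -/

instance : Finite BaseVertex :=
  Finite.of_injective
    (fun x : BaseVertex => match x with
      | .tl => (0 : Fin 11) | .tr => 1 | .br => 2 | .bl => 3 | .u => 4 | .r => 5 | .d => 6
      | .l => 7 | .a => 8 | .b => 9 | .c => 10)
    (by intro x y; cases x <;> cases y <;> simp)

instance : Finite InnerName :=
  Finite.of_injective
    (fun x : InnerName => match x with | .a => (0 : Fin 3) | .b => 1 | .c => 2)
    (by intro x y; cases x <;> cases y <;> simp)

instance : Finite PasteName :=
  Finite.of_injective
    (fun x : PasteName => match x with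
      | .t₁ => (0 : Fin 6) | .t₂ => 1 | .t₃ => 2 | .a => 3 | .b => 4 | .c => 5)
    (by intro x y; cases x <;> cases y <;> simp)

instance {V : Type} [Finite V] : Finite (Quad V) :=
  Finite.of_injective (fun q : Quad V => (q.tl, q.tr, q.br, q.bl))
    (by rintro ⟨⟩ ⟨⟩ h; simpa using h)

instance (K : TileComplex) [Finite K.V] : Finite K.SubVertex :=
  Finite.of_injective
    (fun x : K.SubVertex => match x with
      | .old v => (Sum.inl v : K.V ⊕ (K.graph.edgeSet ⊕ (K.tiles × InnerName)))
      | .mid e => Sum.inr (Sum.inl e)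
      | .inner q i => Sum.inr (Sum.inr (q, i)))
    (by intro x y; cases x <;> cases y <;> simp)

instance (K : TileComplex) [Finite K.V] : Finite K.subdivide.V :=
  inferInstanceAs (Finite K.SubVertex)

instance (K : TileComplex) [Finite K.V] : Finite K.PastePath :=
  Finite.of_injective (fun p : K.PastePath => (p.x₁, p.x₂, p.y, p.z₂, p.z₁))
    (by rintro ⟨⟩ ⟨⟩ h; simpa using h)

instance (K : TileComplex) [Finite K.V] (S : Set K.PastePath) : Finite (K.PasteVertex S) :=
  Finite.of_injective
    (fun x : K.PasteVertex S => match x with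
      | .old v => (Sum.inl v : K.subdivide.V ⊕ (S × PasteName))
      | .new p i => Sum.inr (p, i))
    (by intro x y; cases x <;> cases y <;> simp)

instance (ρ : PastingRule) (K : TileComplex) [Finite K.V] : Finite (K.next ρ).V :=
  inferInstanceAs (Finite (K.PasteVertex (ρ.chosen K)))

instance finite_iterated (ρ : PastingRule) : ∀ n, Finite (iterated ρ n).V
  | 0 => inferInstanceAs (Finite BaseVertex)
  | n + 1 =>
    haveI := finite_iterated ρ n
    inferInstanceAs (Finite ((iterated ρ n).next ρ).V)

/-! ### Growth of the maximal level; neighbours and tiles at old vertices -/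

theorem level_le_maxLevel (K : TileComplex) [Finite K.V] (v : K.V) : K.level v ≤ K.maxLevel :=
  le_csSup (Set.finite_range K.level).bddAbove ⟨v, rfl⟩

theorem maxLevel_eq (K : TileComplex) {m : ℕ} (hle : ∀ v, K.level v ≤ m)
    (hex : ∃ v, K.level v = m) : K.maxLevel = m :=
  IsGreatest.csSup_eq ⟨hex, by rintro _ ⟨v, rfl⟩; exact hle v⟩

/-- An edge is required because its midpoint is the witness attaining the new maximum. -/
theorem maxLevel_subdivide (K : TileComplex) [Finite K.V] (hK : K.graph.edgeSet.Nonempty) :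
    K.subdivide.maxLevel = K.maxLevel + 1 := by
  obtain ⟨e, he⟩ := hK
  refine maxLevel_eq _ (fun v => ?_) ⟨.mid ⟨e, he⟩, rfl⟩
  cases v with
  | old v => exact (K.level_le_maxLevel v).trans (Nat.le_succ _)
  | mid e => exact le_rfl
  | inner q i => exact le_rfl

/-- Of the eight inner edges of a pattern, only those from `c` to `bl` and `br` end at a corner; all
other edges at an old vertex are halves of old edges. -/
theorem subdivide_adj_old_iff (K : TileComplex) (v : K.V) (x : K.SubVertex) :
    K.subdivide.graph.Adj (.old v) x ↔
      (∃ e : K.graph.edgeSet, v ∈ e.1 ∧ x = .mid e) ∨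
      ∃ q : K.tiles, (v = q.1.bl ∨ v = q.1.br) ∧ x = .inner q .c := by
  simp only [subdivide, SimpleGraph.fromEdgeSet_adj, subEdges, Set.mem_union, Set.mem_ofPred_eq,
    Set.mem_iUnion]
  constructor
  · rintro ⟨⟨e, w, hw, h⟩ | ⟨q, h⟩, -⟩
    · rcases Sym2.eq_iff.1 h with ⟨h1, h2⟩ | ⟨h1, h2⟩
      · cases h1
        exact Or.inl ⟨e, hw, h2⟩
      · cases h1
    · simp only [Pattern.edges, subPattern, Set.mem_insert_iff, Set.mem_singleton_iff,
        Sym2.eq_iff, SubVertex.old.injEq, reduceCtorEq, false_and, or_false,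
        false_or] at h
      rcases h with ⟨rfl, rfl⟩ | ⟨rfl, rfl⟩ | ⟨rfl, rfl⟩ | ⟨rfl, rfl⟩ | ⟨rfl, rfl⟩ | ⟨rfl, rfl⟩ |
        ⟨rfl, rfl⟩ | ⟨rfl, rfl⟩ | ⟨rfl, rfl⟩ | ⟨rfl, rfl⟩
      -- The first eight cases are half sides; the last two are the edges from `c`. Closing the
      -- ninth goal moves the tenth into its place.
      on_goal 9 => exact Or.inr ⟨q, Or.inl rfl, rfl⟩
      on_goal 9 => exact Or.inr ⟨q, Or.inr rfl, rfl⟩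
      all_goals exact Or.inl ⟨_, by simp, rfl⟩
  · rintro (⟨e, hv, rfl⟩ | ⟨q, hv, rfl⟩)
    · exact ⟨Or.inl ⟨e, v, hv, rfl⟩, by simp⟩
    · refine ⟨Or.inr ⟨q, ?_⟩, by simp⟩
      rcases hv with rfl | rfl <;> simp [Pattern.edges, subPattern]

theorem edgeSet_nonempty_next (ρ : PastingRule) (K : TileComplex)
    (hK : K.graph.edgeSet.Nonempty) : (K.next ρ).graph.edgeSet.Nonempty := by
  obtain ⟨e, he⟩ := hK
  induction e using Sym2.ind with
  | _ x y =>
    have h : K.subdivide.graph.Adj (.old x) (.mid ⟨s(x, y), he⟩) :=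
      (K.subdivide_adj_old_iff x _).2 (Or.inl ⟨_, by simp, rfl⟩)
    refine ⟨Sym2.map .old s(.old x, .mid ⟨s(x, y), he⟩), ?_⟩
    have hm : Sym2.map .old s(.old x, .mid ⟨s(x, y), he⟩) ∈ K.pasteEdges (ρ.chosen K) :=
      Or.inl ⟨_, h, rfl⟩
    simp only [next, subdividePaste, SimpleGraph.edgeSet_fromEdgeSet]
    exact ⟨hm, K.pasteEdges_not_isDiag _ _ hm⟩

theorem edgeSet_nonempty_iterated (ρ : PastingRule) :
    ∀ n, (iterated ρ n).graph.edgeSet.Nonempty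
  | 0 => ⟨s(BaseVertex.tl, BaseVertex.u),
      (base.tiles_isCycle ⟨BaseVertex.tl, .u, .a, .l⟩ (Or.inl rfl)).1⟩
  | n + 1 => edgeSet_nonempty_next ρ _ (edgeSet_nonempty_iterated ρ n)

theorem maxLevel_next (ρ : PastingRule) (K : TileComplex) [Finite K.V]
    (hK : K.graph.edgeSet.Nonempty) : (K.next ρ).maxLevel = K.maxLevel + 1 := by
  have hs := K.maxLevel_subdivide hK
  obtain ⟨e, he⟩ := hK
  refine maxLevel_eq _ (fun v => ?_) ⟨.old (.mid ⟨e, he⟩), rfl⟩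
  rw [← hs]
  cases v with
  | old v => exact K.subdivide.level_le_maxLevel v
  | new p i => cases i <;> simp [next, subdividePaste, pasteLevel]

theorem maxLevel_iterated (ρ : PastingRule) : ∀ n, (iterated ρ n).maxLevel = n
  | 0 => maxLevel_eq _ (fun _ => le_rfl) ⟨BaseVertex.tl, rfl⟩
  | n + 1 => by
    rw [iterated, maxLevel_next ρ _ (edgeSet_nonempty_iterated ρ n), maxLevel_iterated ρ n]

theorem old_notMem_edges_pastePattern (K : TileComplex) (S : Set K.PastePath) (p : S)
    (w : K.subdivide.V)
    (hw : w ≠ p.1.x₁ ∧ w ≠ p.1.x₂ ∧ w ≠ p.1.y ∧ w ≠ p.1.z₂ ∧ w ≠ p.1.z₁)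
    (x : K.PasteVertex S) : s(.old w, x) ∉ (K.pastePattern S p).edges := by
  obtain ⟨h1, h2, h3, h4, h5⟩ := hw
  simp [Pattern.edges, pastePattern, h1, h2, h3, h4, h5]

theorem old_ne_of_mem_tiles_pastePattern (K : TileComplex) (S : Set K.PastePath) (p : S)
    (w : K.subdivide.V)
    (hw : w ≠ p.1.x₁ ∧ w ≠ p.1.x₂ ∧ w ≠ p.1.y ∧ w ≠ p.1.z₂ ∧ w ≠ p.1.z₁)
    {t : Quad (K.PasteVertex S)} (ht : t ∈ (K.pastePattern S p).tiles) :
    .old w ≠ t.bl ∧ .old w ≠ t.br := by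
  obtain ⟨h1, h2, h3, h4, h5⟩ := hw
  simp only [Pattern.tiles, pastePattern, Set.mem_insert_iff, Set.mem_singleton_iff] at ht
  rcases ht with rfl | rfl | rfl | rfl | rfl | rfl <;> simp [h2, h4, h5]

/-- A pasted pattern meets the old complex only in the five vertices of its path. Avoiding every
path, chosen or not, makes the result independent of `S`. -/
theorem neighborSet_subdividePaste_old (K : TileComplex) (S : Set K.PastePath)
    (w : K.subdivide.V)
    (hw : ∀ p : K.PastePath, w ≠ p.x₁ ∧ w ≠ p.x₂ ∧ w ≠ p.y ∧ w ≠ p.z₂ ∧ w ≠ p.z₁) :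
    (K.subdividePaste S).graph.neighborSet (PasteVertex.old w) =
      PasteVertex.old '' K.subdivide.graph.neighborSet w := by
  have hadj (x : K.PasteVertex S) : (K.subdividePaste S).graph.Adj (PasteVertex.old w) x ↔
      s(.old w, x) ∈ K.pasteEdges S :=
    ⟨fun h => h.1, fun h => ⟨h, fun h' => K.pasteEdges_not_isDiag S _ h (Sym2.mk_isDiag_iff.2 h')⟩⟩
  ext x
  refine (hadj x).trans ⟨?_, ?_⟩
  · rintro (⟨e, he, h⟩ | h)
    · induction e using Sym2.ind with
      | _ a b =>
        rcases Sym2.eq_iff.1 h with ⟨h1, h2⟩ | ⟨h1, h2⟩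
        · cases h1
          exact ⟨b, he, h2⟩
        · cases h2
          exact ⟨a, K.subdivide.graph.adj_symm he, h1⟩
    · obtain ⟨p, h⟩ := Set.mem_iUnion.1 h
      exact (K.old_notMem_edges_pastePattern S p w (hw p.1) x h).elim
  · rintro ⟨b, hb, rfl⟩
    exact Or.inl ⟨s(w, b), hb, rfl⟩

theorem corner_of_mem_tiles_subdivide (K : TileComplex) (v : K.V) {t : Quad K.SubVertex}
    (ht : t ∈ K.subdivide.tiles) :
    .old v ≠ t.bl ∧ (.old v = t.br → ∃ q ∈ K.tiles, v = q.bl) := by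
  obtain ⟨q, ht⟩ := Set.mem_iUnion.1 ht
  simp only [Pattern.tiles, subPattern, Set.mem_insert_iff, Set.mem_singleton_iff] at ht
  rcases ht with rfl | rfl | rfl | rfl | rfl | rfl
  -- The bottom tile has the former `bl` as its bottom right corner; in the other five tiles both
  -- bottom corners are new vertices.
  on_goal 6 => exact ⟨by simp, fun h => ⟨q.1, q.2, SubVertex.old.inj h⟩⟩
  all_goals simp

/-- A vertex is settled if its level is so low that no later pasting involves it. -/
def Settled (K : TileComplex) (v : K.V) : Prop := K.level v + 1 < K.maxLevel

/-! ### Settled and stable vertices -/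

section Settled

variable {K : TileComplex} [Finite K.V] {v : K.V}

theorem Settled.next (hK : K.graph.edgeSet.Nonempty) (hv : K.Settled v) (ρ : PastingRule) :
    (K.next ρ).Settled (K.toNext ρ v) := by
  rw [Settled, maxLevel_next ρ K hK]
  exact Nat.lt_succ_of_lt hv

/-- If `m` is the maximal level of `K`, the ends of a path have level `m` and its centre `m - 1`,
both above a settled level; `x₂` and `z₂` are new midpoints, hence not old vertices. -/
theorem Settled.notMem_path (hK : K.graph.edgeSet.Nonempty) (hv : K.Settled v)
    (p : K.PastePath) :
    .old v ≠ p.x₁ ∧ .old v ≠ p.x₂ ∧ .old v ≠ p.y ∧ .old v ≠ p.z₂ ∧ .old v ≠ p.z₁ := by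
  have hs := K.maxLevel_subdivide hK
  have hl : K.subdivide.level (.old v) = K.level v := rfl
  have h₁ := p.level_x₁
  have h₂ := p.level_y
  have h₃ := p.level_z₁
  unfold Settled at hv
  refine ⟨fun h => ?_, fun h => ?_, fun h => ?_, fun h => ?_, fun h => ?_⟩
  · rw [← h] at h₁; omega
  · have := p.mid_x₂; rw [← h] at this; cases this
  · rw [← h] at h₂; omega
  · have := p.mid_z₂; rw [← h] at this; cases this
  · rw [← h] at h₃; omega

/-- The neighbours of a settled vertex in the next complex are created by the subdivision. -/
theorem Settled.neighborSet_next (hK : K.graph.edgeSet.Nonempty) (hv : K.Settled v)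
    (ρ : PastingRule) :
    (K.next ρ).graph.neighborSet (K.toNext ρ v) =
      PasteVertex.old '' K.subdivide.graph.neighborSet (.old v) :=
  neighborSet_subdividePaste_old K _ _ fun p => hv.notMem_path hK p

/-- The position of a settled vertex in the tiles of the next complex. -/
theorem Settled.corner_of_mem_tiles_next (hK : K.graph.edgeSet.Nonempty) (hv : K.Settled v)
    (ρ : PastingRule) {t : Quad (K.next ρ).V} (ht : t ∈ (K.next ρ).tiles) :
    K.toNext ρ v ≠ t.bl ∧ (K.toNext ρ v = t.br → ∃ q ∈ K.tiles, v = q.bl) := by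
  rcases ht with ⟨t, ht, rfl⟩ | ht
  · obtain ⟨h1, h2⟩ := K.corner_of_mem_tiles_subdivide v ht
    exact ⟨fun h => h1 (PasteVertex.old.inj h), fun h => h2 (PasteVertex.old.inj h)⟩
  · obtain ⟨p, ht⟩ := Set.mem_iUnion.1 ht
    obtain ⟨h1, h2⟩ := old_ne_of_mem_tiles_pastePattern K _ p _ (hv.notMem_path hK p.1) ht
    exact ⟨h1, fun h => (h2 h).elim⟩

end Settled

/-- The degree of an old vertex is unchanged by a subdivision if the vertex is not a bottom corner
of any tile. -/
theorem encard_neighborSet_subdivide_old (K : TileComplex) (v : K.V)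
    (hv : ∀ q ∈ K.tiles, v ≠ q.bl ∧ v ≠ q.br) :
    (K.subdivide.graph.neighborSet (.old v)).encard = K.degree v := by
  have hmid (w : K.graph.neighborSet v) : s(v, w.1) ∈ K.graph.edgeSet := w.2
  -- Neighbours correspond to midpoints: `w` goes to the midpoint of the edge from `v` to `w`.
  have hinj : Function.Injective fun w : K.graph.neighborSet v =>
      SubVertex.mid (K := K) ⟨s(v, w.1), hmid w⟩ := by
    intro a b h
    exact Subtype.ext (Sym2.congr_right.1 (Subtype.ext_iff.1 (SubVertex.mid.inj h)))
  have hrange : K.subdivide.graph.neighborSet (.old v) =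
      Set.range fun w : K.graph.neighborSet v => SubVertex.mid (K := K) ⟨s(v, w.1), hmid w⟩ := by
    ext x
    refine (K.subdivide_adj_old_iff v x).trans ⟨?_, ?_⟩
    · rintro (⟨⟨e, he⟩, hve, rfl⟩ | ⟨q, h, -⟩)
      · obtain ⟨w, rfl⟩ := Sym2.mem_iff_exists.1 hve
        exact ⟨⟨w, he⟩, rfl⟩
      · exact (h.elim (hv q.1 q.2).1 (hv q.1 q.2).2).elim
    · rintro ⟨w, rfl⟩
      exact Or.inl ⟨_, by simp, rfl⟩
  rw [hrange, ← Set.image_univ]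
  exact (hinj.encard_image _).trans (Set.encard_univ _)

/-- A settled vertex that is not a bottom corner of any tile. -/
structure Stable (K : TileComplex) (v : K.V) : Prop where
  settled : K.Settled v
  ne_bl : ∀ q ∈ K.tiles, v ≠ q.bl
  ne_br : ∀ q ∈ K.tiles, v ≠ q.br

theorem Stable.next {K : TileComplex} [Finite K.V] {v : K.V} (hK : K.graph.edgeSet.Nonempty)
    (hv : K.Stable v) (ρ : PastingRule) : (K.next ρ).Stable (K.toNext ρ v) where
  settled := hv.settled.next hK ρ
  ne_bl _ ht := (hv.settled.corner_of_mem_tiles_next hK ρ ht).1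
  ne_br _ ht h :=
    have ⟨q, hq, hb⟩ := (hv.settled.corner_of_mem_tiles_next hK ρ ht).2 h
    hv.ne_bl q hq hb

theorem Stable.degree_next {K : TileComplex} [Finite K.V] {v : K.V}
    (hK : K.graph.edgeSet.Nonempty) (hv : K.Stable v) (ρ : PastingRule) :
    (K.next ρ).degree (K.toNext ρ v) = K.degree v := by
  have hinj : Function.Injective (PasteVertex.old (K := K) (S := ρ.chosen K)) :=
    fun _ _ h => PasteVertex.old.inj h
  rw [degree, hv.settled.neighborSet_next hK ρ]
  exact (hinj.encard_image _).trans
    (K.encard_neighborSet_subdivide_old v fun q hq => ⟨hv.ne_bl q hq, hv.ne_br q hq⟩)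

/-- The first iteration excludes the bottom left position; being bottom right after the second would
need a bottom left position after the first. -/
theorem Settled.stable_next_next {K : TileComplex} [Finite K.V] {v : K.V}
    (hK : K.graph.edgeSet.Nonempty) (hv : K.Settled v) (ρ : PastingRule) :
    ((K.next ρ).next ρ).Stable ((K.next ρ).toNext ρ (K.toNext ρ v)) := by
  have hK' := edgeSet_nonempty_next ρ K hK
  have hv' := hv.next hK ρ
  refine ⟨hv'.next hK' ρ, fun t ht => (hv'.corner_of_mem_tiles_next hK' ρ ht).1,
    fun t ht h => ?_⟩
  obtain ⟨q, hq, hb⟩ := (hv'.corner_of_mem_tiles_next hK' ρ ht).2 h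
  exact (hv.corner_of_mem_tiles_next hK ρ hq).1 hb

/-! ### Following a vertex through the sequence -/

theorem transport_self (ρ : PastingRule) {n : ℕ} (h : n ≤ n) (v : (iterated ρ n).V) :
    transport ρ h v = v :=
  Nat.leRecOn_self (C := fun j => (iterated ρ j).V) v

theorem transport_succ (ρ : PastingRule) {n m : ℕ} (h : n ≤ m) (h' : n ≤ m + 1)
    (v : (iterated ρ n).V) :
    transport ρ h' v = toNext ρ (iterated ρ m) (transport ρ h v) :=
  Nat.leRecOn_succ (C := fun j => (iterated ρ j).V) h v

theorem level_transport (ρ : PastingRule) {n m : ℕ} (h : n ≤ m) (v : (iterated ρ n).V) :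
    (iterated ρ m).level (transport ρ h v) = (iterated ρ n).level v := by
  induction m, h using Nat.le_induction with
  | base => rw [transport_self]
  | succ m h ih =>
    rw [transport_succ ρ h]
    exact ih

theorem settled_transport (ρ : PastingRule) {n m : ℕ} (h : n + 2 ≤ m) (v : (iterated ρ n).V) :
    (iterated ρ m).Settled (transport ρ ((Nat.le_add_right n 2).trans h) v) := by
  have := (iterated ρ n).level_le_maxLevel v
  rw [maxLevel_iterated] at this
  rw [Settled, level_transport, maxLevel_iterated]
  omega

theorem stable_transport (ρ : PastingRule) {n m : ℕ} (h : n + 4 ≤ m) (v : (iterated ρ n).V) :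
    (iterated ρ m).Stable (transport ρ ((Nat.le_add_right n 4).trans h) v) := by
  induction m, h using Nat.le_induction with
  | base =>
    rw [transport_succ ρ (Nat.le_add_right n 3), transport_succ ρ (Nat.le_add_right n 2)]
    exact (settled_transport ρ le_rfl v).stable_next_next (edgeSet_nonempty_iterated ρ _) ρ
  | succ m h ih =>
    rw [transport_succ ρ ((Nat.le_add_right n 4).trans h)]
    exact ih.next (edgeSet_nonempty_iterated ρ m) ρ

end TileComplex

theorem mainTheorem7 (ρ : TileComplex.PastingRule) (n : ℕ) (X : (TileComplex.iterated ρ n).V) :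
    ∃ (N : ℕ) (hN : n ≤ N),
      (TileComplex.iterated ρ N).degree (TileComplex.transport ρ hN X) < ⊤ ∧
      ∀ k : ℕ,
        (TileComplex.iterated ρ (N + k)).degree
            (TileComplex.transport ρ (hN.trans (Nat.le_add_right N k)) X) =
          (TileComplex.iterated ρ N).degree (TileComplex.transport ρ hN X) := by
  -- Two iterations settle `X`, and two more remove it from all bottom corners.
  refine ⟨n + 4, Nat.le_add_right n 4, (Set.toFinite _).encard_lt_top, fun k => ?_⟩
  induction k with
  | zero => rfl
  | succ k ih =>
    rw [← ih]
    have h : n + 4 ≤ n + 4 + k := Nat.le_add_right _ _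
    have hT := TileComplex.transport_succ ρ ((Nat.le_add_right n 4).trans h)
      ((Nat.le_add_right n 4).trans (h.trans (Nat.le_succ _))) X
    exact (congrArg (TileComplex.iterated ρ (n + 4 + k + 1)).degree hT).trans
      ((TileComplex.stable_transport ρ h X).degree_next
        (TileComplex.edgeSet_nonempty_iterated ρ _) ρ)
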